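/- Let $d\ge 1$ be an integer and $s>0$ real. For $u:\mathbb R^d\to\mathbb C$ put $$(-\Delta)^s u:=\mathscr F^{-1}\big[|\xi|^{2s}\mathscr F[u]\big],\qquad \mathscr F[u](\xi)=\frac1{(2\pi)^{d/2}}\int_{\mathbb R^d}u(x)e^{-i\xi\cdot x}\,dx,\qquad \mathscr F^{-1}[v](x)=\frac1{(2\pi)^{d/2}}\int_{\mathbb R^d}v(\xi)e^{ix\cdot\xi}\,d\xi ,$$ and let ${}_1F_1(a;b;z)=\sum_{n\ge0}\frac{(a)_n}{(b)_n}\frac{z^n}{n!}$ be Kummer's confluent hypergeometric function. For $u(x)=e^{-|x|^2}$ the functions $u$ and $|\xi|^{2s}\mathscr F[u](\xi)$ are integrable, and for every $x\in\mathbb R^d$ $$(-\Delta)^s\big\{e^{-|x|^2}\big\}=\frac{2^{2s}\,\Gamma(s+d/2)}{\Gamma(d/2)}\;{}_1F_1\Big(s+\frac d2;\frac d2;-|x|^2\Big).$$ Moreover, if $s$ is not an integer, then as $|x|\to\infty$ $$(-\Delta)^s\big\{e^{-|x|^2}\big\}=-\frac{2^{2s}\sin(\pi s)}{\pi}\,\frac{\Gamma(s+d/2)\,\Gamma(1+s)}{|x|^{d+2s}}\,\big\{1+O(|x|^{-2})\big\}.$$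 -/

import Mathlib

open scoped Nat
open Asymptotics

/-- The Fourier transform on `ℝ^d` in the unitary normalisation with angular frequency,
`F[u](ξ) = (2π)^{-d/2} ∫ u(x) e^{-i ξ·x} dx`. -/
noncomputable def fourierTr {d : ℕ} (u : EuclideanSpace ℝ (Fin d) → ℂ)
    (ξ : EuclideanSpace ℝ (Fin d)) : ℂ :=
  (((2 * Real.pi) ^ (-(d : ℝ) / 2) : ℝ) : ℂ) *
    ∫ x : EuclideanSpace ℝ (Fin d), u x * Complex.exp (-(Complex.I * ((inner ℝ ξ x : ℝ) : ℂ)))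

/-- The inverse Fourier transform `F⁻¹[v](x) = (2π)^{-d/2} ∫ v(ξ) e^{i x·ξ} dξ`. -/
noncomputable def fourierTrInv {d : ℕ} (v : EuclideanSpace ℝ (Fin d) → ℂ)
    (x : EuclideanSpace ℝ (Fin d)) : ℂ :=
  (((2 * Real.pi) ^ (-(d : ℝ) / 2) : ℝ) : ℂ) *
    ∫ ξ : EuclideanSpace ℝ (Fin d), v ξ * Complex.exp (Complex.I * ((inner ℝ x ξ : ℝ) : ℂ))

/-- The symbol side of the fractional Laplacian: `ξ ↦ |ξ|^{2s} F[u](ξ)`. -/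
noncomputable def fracLaplaceSymbol {d : ℕ} (s : ℝ) (u : EuclideanSpace ℝ (Fin d) → ℂ)
    (ξ : EuclideanSpace ℝ (Fin d)) : ℂ :=
  ((‖ξ‖ ^ (2 * s) : ℝ) : ℂ) * fourierTr u ξ

/-- The fractional Laplacian `(-Δ)^s u = F⁻¹[|ξ|^{2s} F[u]]`. The integrals are Lebesgue integrals,
so this is meaningful when `u` and `fracLaplaceSymbol s u` are integrable
(for example for Schwartz functions and `s > 0`). -/
noncomputable def fracLaplacian {d : ℕ} (s : ℝ) (u : EuclideanSpace ℝ (Fin d) → ℂ) :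
    EuclideanSpace ℝ (Fin d) → ℂ :=
  fourierTrInv (fracLaplaceSymbol s u)

/-- The Gaussian `x ↦ e^{-|x|²}` on `ℝ^d`. -/
noncomputable def gaussianFn (d : ℕ) (x : EuclideanSpace ℝ (Fin d)) : ℂ :=
  ((Real.exp (-‖x‖ ^ 2) : ℝ) : ℂ)

/-- Kummer's confluent hypergeometric function `₁F₁(a; b; z)` (for `b ≠ 0, -1, -2, …`), obtained
from Mathlib's regularized hypergeometric function, which is divided by `Γ(b)`. -/
noncomputable def kummer1F1 (a b z : ℂ) : ℂ :=
  Complex.Gamma b * Complex.regularizedHGFun {a} {b} z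

/-- `₁F₁(a; b; z) = ∑ (a)_n / (b)_n * z^n / n!`, with convergence for every `z`. -/
theorem hasSum_kummer1F1 (a b z : ℂ) (hb : ∀ k : ℕ, b ≠ -k) :
    HasSum (fun n : ℕ => (ascPochhammer ℂ n).eval a / (ascPochhammer ℂ n).eval b * (z ^ n / n !))
      (kummer1F1 a b z) := by
  have hr : (Complex.regularizedHGFunSeries {a} {b}).radius = ⊤ :=
    Complex.radius_regularizedHGFunSeries_eq_top (by simp)
  have h := (Complex.regularizedHGFunSeries {a} {b}).hasSum (x := z) (by simp [hr])
  have h2 := h.mul_left (Complex.Gamma b)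
  have hG : Complex.Gamma b ≠ 0 := Complex.Gamma_ne_zero hb
  have key : (fun n : ℕ => (ascPochhammer ℂ n).eval a / (ascPochhammer ℂ n).eval b *
      (z ^ n / n !)) =
      fun n : ℕ => Complex.Gamma b * (Complex.regularizedHGFunSeries {a} {b} n) fun _ => z := by
    funext n
    have e := Complex.Gamma_add_nat_div_Gamma_eq (n := n) b hb
    have e2 : Complex.Gamma (b + n) = (ascPochhammer ℂ n).eval b * Complex.Gamma b := by
      rw [← e]; field_simp
    simp [Complex.regularizedHGFunSeries, Complex.regularizedHGFunCoeff, e2]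
    field_simp
  rw [key]
  exact h2

/-!
The idea is to expand the plane wave in `F⁻¹` in powers of `x·ξ` and to integrate term by term.
Since `F[e^{-|x|²}](ξ) = 2^{-d/2} e^{-|ξ|²/4}`, this leaves the moments
`∫ |ξ|^{2s} e^{-|ξ|²/4} (x·ξ)ⁿ dξ` (`hasSum_gaussMoment`). In polar coordinates such a moment is a
spherical integral independent of `s` times a Gamma integral in the radius, so it equals the moment
for `s = 0` times `4^s Γ(s + (d+n)/2) / Γ((d+n)/2)` (`gaussMoment_eq`). The moments for `s = 0`
need no spherical integration: they are the Taylor coefficients of the Fourier transform of a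
Gaussian, which is known in closed form (`gaussMoment_zero`). The odd moments vanish and the even
ones come from the powers of `-|x|²` in `e^{-|x|²}`, which gives
`4^s ∑ₖ Γ(s+d/2+k)/Γ(d/2+k) (-|x|²)ᵏ/k!` (`fracLaplacian_gaussianFn`). This series is
`gammaSeries (s + d/2) (d/2) (-|x|²)`, a multiple of Kummer's function (`ofReal_gammaSeries`).

For the asymptotics it remains to show, for `a, b > 0` and `z → ∞`,
`gammaSeries a b (-z) = Γ(a)/Γ(b-a) z^{-a} + O(z^{-a-1})` (`gammaSeries_asymptotic`). If `b ≥ a + 2`,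
this is Watson's lemma applied to Euler's integral `∫₀¹ e^{-zt} t^{a-1} (1-t)^{b-a-1} dt`
(`gammaSeries_asymptotic_of_two_le`). Here, however, `b - a = -s` is negative. With `F` for
`gammaSeries`, the contiguous relation `F(a, b, z) = b F(a, b+1, z) + z F(a+1, b+2, z)`
(`gammaSeries_contiguous`) expresses the series by two series whose
parameters differ by `b - a + 1`, and the expansion passes from these to `F(a, b)` because
`1/Γ(x) = x/Γ(x+1)`, so that an induction reaches every value of `b - a`. With
`a = s + d/2` and `b = d/2` the coefficient is `Γ(s+d/2)/Γ(-s)`, and the reflection formula brings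
in the sine.
-/

open MeasureTheory Set

/-! ### The confluent hypergeometric series with real parameters -/

/-- The series `∑ Γ(a+n)/Γ(b+n) zⁿ/n!`, that is, `Γ(a)/Γ(b) · ₁F₁(a; b; z)` for real `a, b > 0`. -/
noncomputable def gammaSeries (a b z : ℝ) : ℝ :=
  ∑' n : ℕ, Real.Gamma (a + n) / Real.Gamma (b + n) * (z ^ n / n !)

theorem Complex.Gamma_add_nat_eq {a : ℝ} (ha : 0 < a) (n : ℕ) :
    ((Real.Gamma (a + n) : ℝ) : ℂ) =
      (ascPochhammer ℂ n).eval (a : ℂ) * ((Real.Gamma a : ℝ) : ℂ) := by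
  have hne : ∀ k : ℕ, (a : ℂ) ≠ -k := fun k h => by
    have h' : a = -(k : ℝ) := by exact_mod_cast h
    have : (0 : ℝ) ≤ k := k.cast_nonneg
    linarith
  rw [← Complex.Gamma_add_nat_div_Gamma_eq (n := n) (a : ℂ) hne, ← Complex.Gamma_ofReal,
    ← Complex.Gamma_ofReal, div_mul_cancel₀ _ (Complex.Gamma_ne_zero hne)]
  push_cast
  rfl

theorem hasSum_gammaSeries_kummer1F1 {a b : ℝ} (ha : 0 < a) (hb : 0 < b) (z : ℝ) :
    HasSum (fun n : ℕ =>
        ((Real.Gamma (a + n) / Real.Gamma (b + n) * (z ^ n / n !) : ℝ) : ℂ))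
      (((Real.Gamma a / Real.Gamma b : ℝ) : ℂ) * kummer1F1 a b z) := by
  have hne : ∀ k : ℕ, (b : ℂ) ≠ -k := fun k h => by
    have h' : b = -(k : ℝ) := by exact_mod_cast h
    have : (0 : ℝ) ≤ k := k.cast_nonneg
    linarith
  convert! (hasSum_kummer1F1 a b z hne).mul_left ((Real.Gamma a / Real.Gamma b : ℝ) : ℂ) using 2
    with n
  rw [Complex.ofReal_mul, Complex.ofReal_div, Complex.Gamma_add_nat_eq ha,
    Complex.Gamma_add_nat_eq hb]
  push_cast
  ring

theorem hasSum_gammaSeries {a b : ℝ} (ha : 0 < a) (hb : 0 < b) (z : ℝ) :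
    HasSum (fun n : ℕ => Real.Gamma (a + n) / Real.Gamma (b + n) * (z ^ n / n !))
      (gammaSeries a b z) :=
  (Complex.summable_ofReal.1 (hasSum_gammaSeries_kummer1F1 ha hb z).summable).hasSum

theorem ofReal_gammaSeries {a b : ℝ} (ha : 0 < a) (hb : 0 < b) (z : ℝ) :
    ((gammaSeries a b z : ℝ) : ℂ) =
      ((Real.Gamma a / Real.Gamma b : ℝ) : ℂ) * kummer1F1 a b z :=
  (Complex.hasSum_ofReal.2 (hasSum_gammaSeries ha hb z)).unique
    (hasSum_gammaSeries_kummer1F1 ha hb z)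

/-- A contiguous relation that raises the difference of the two parameters by one. -/
theorem gammaSeries_contiguous {a b : ℝ} (ha : 0 < a) (hb : 0 < b) (z : ℝ) :
    gammaSeries a b z = b * gammaSeries a (b + 1) z + z * gammaSeries (a + 1) (b + 2) z := by
  have h1 := (hasSum_gammaSeries ha (by linarith : 0 < b + 1) z).mul_left b
  have h2 : HasSum (fun n : ℕ => (n : ℝ) * (Real.Gamma (a + n) / Real.Gamma (b + 1 + n) *
      (z ^ n / n !))) (z * gammaSeries (a + 1) (b + 2) z) := by
    -- the factor `n` removes the term `n = 0`, and a shift of the index cancels it against `n!`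
    rw [← hasSum_nat_add_iff' 1, Finset.sum_range_one, Nat.cast_zero, zero_mul, sub_zero]
    convert! (hasSum_gammaSeries (by linarith : 0 < a + 1) (by linarith : 0 < b + 2) z).mul_left z
      using 2 with n
    have e1 : a + ((n + 1 : ℕ) : ℝ) = a + 1 + n := by push_cast; ring
    have e2 : b + 1 + ((n + 1 : ℕ) : ℝ) = b + 2 + n := by push_cast; ring
    rw [e1, e2, Nat.factorial_succ, pow_succ]
    have : (n ! : ℝ) ≠ 0 := by positivity
    push_cast
    field_simp
  refine (hasSum_gammaSeries ha hb z).unique ?_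
  convert! h1.add h2 using 2 with n
  have hbn : 0 < b + n := by positivity
  have e : b + 1 + n = b + n + 1 := by ring
  rw [e, Real.Gamma_add_one hbn.ne']
  have := (Real.Gamma_pos_of_pos hbn).ne'
  field_simp

/-! ### Euler's integral representation -/

theorem integrableOn_beta {p q : ℝ} (hp : 0 < p) (hq : 0 < q) :
    IntegrableOn (fun t : ℝ => t ^ (p - 1) * (1 - t) ^ (q - 1)) (Ioo 0 1) := by
  have h := Complex.betaIntegral_convergent (u := p) (v := q) (by simpa) (by simpa)
  rw [intervalIntegrable_iff_integrableOn_Ioo_of_le zero_le_one] at h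
  refine h.re.congr ?_
  filter_upwards [ae_restrict_mem measurableSet_Ioo] with t ht
  have h1 : ((t : ℂ) ^ ((p : ℂ) - 1)) = ((t ^ (p - 1) : ℝ) : ℂ) := by
    rw [Complex.ofReal_cpow ht.1.le]; push_cast; rfl
  have h2 : ((1 - t : ℂ) ^ ((q : ℂ) - 1)) = (((1 - t) ^ (q - 1) : ℝ) : ℂ) := by
    rw [Complex.ofReal_cpow (sub_nonneg.2 ht.2.le)]; push_cast; rfl
  rw [h1, h2, ← Complex.ofReal_mul]
  simp

theorem integral_beta {p q : ℝ} (hp : 0 < p) (hq : 0 < q) :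
    ∫ t in Ioo (0 : ℝ) 1, t ^ (p - 1) * (1 - t) ^ (q - 1) =
      Real.Gamma p * Real.Gamma q / Real.Gamma (p + q) := by
  have h := Complex.betaIntegral_eq_Gamma_mul_div p q (by simpa) (by simpa)
  rw [Complex.betaIntegral, intervalIntegral.integral_of_le zero_le_one,
    integral_Ioc_eq_integral_Ioo] at h
  have key : ∫ t in Ioo (0 : ℝ) 1, (t : ℂ) ^ ((p : ℂ) - 1) * (1 - t : ℂ) ^ ((q : ℂ) - 1) =
      ∫ t in Ioo (0 : ℝ) 1, ((t ^ (p - 1) * (1 - t) ^ (q - 1) : ℝ) : ℂ) := by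
    refine setIntegral_congr_fun measurableSet_Ioo fun t ht => ?_
    rw [Complex.ofReal_mul, Complex.ofReal_cpow ht.1.le,
      Complex.ofReal_cpow (sub_nonneg.2 ht.2.le)]
    push_cast
    rfl
  rw [key, integral_complex_ofReal, ← Complex.ofReal_add, Complex.Gamma_ofReal,
    Complex.Gamma_ofReal, Complex.Gamma_ofReal] at h
  exact_mod_cast h

/-- Euler's integral representation. -/
theorem Gamma_mul_gammaSeries {a b : ℝ} (ha : 0 < a) (hab : a < b) (z : ℝ) :
    Real.Gamma (b - a) * gammaSeries a b z =
      ∫ t in Ioo (0 : ℝ) 1, Real.exp (z * t) * (t ^ (a - 1) * (1 - t) ^ (b - a - 1)) := by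
  have hD : 0 < b - a := sub_pos.2 hab
  have hw := integrableOn_beta ha hD
  have hexp : ∀ y : ℝ, HasSum (fun n : ℕ => y ^ n / n !) (Real.exp y) := fun y => by
    rw [Real.exp_eq_exp_ℝ]; exact NormedSpace.expSeries_div_hasSum_exp y
  have h1 : HasSum (fun n : ℕ => ∫ t in Ioo (0 : ℝ) 1,
      (z * t) ^ n / n ! * (t ^ (a - 1) * (1 - t) ^ (b - a - 1)))
      (∫ t in Ioo (0 : ℝ) 1, Real.exp (z * t) * (t ^ (a - 1) * (1 - t) ^ (b - a - 1))) := by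
    refine hasSum_integral_of_dominated_convergence
      (fun n t => |z| ^ n / n ! * (t ^ (a - 1) * (1 - t) ^ (b - a - 1))) (fun n => ?_)
      (fun n => ?_) ?_ ?_ ?_
    · exact (Continuous.aestronglyMeasurable (by fun_prop)).mul hw.aestronglyMeasurable
    · filter_upwards [ae_restrict_mem measurableSet_Ioo] with t ht
      have h0 : 0 ≤ t ^ (a - 1) * (1 - t) ^ (b - a - 1) :=
        mul_nonneg (Real.rpow_nonneg ht.1.le _) (Real.rpow_nonneg (sub_nonneg.2 ht.2.le) _)
      rw [norm_mul, Real.norm_of_nonneg h0, norm_div, norm_pow, norm_mul, Real.norm_eq_abs,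
        Real.norm_eq_abs, abs_of_pos ht.1, Real.norm_natCast]
      have h1 : |z| * t ≤ |z| := mul_le_of_le_one_right (abs_nonneg _) ht.2.le
      have h2 : 0 ≤ |z| * t := mul_nonneg (abs_nonneg _) ht.1.le
      gcongr
    · exact Filter.Eventually.of_forall fun t => (hexp |z|).summable.mul_right _
    · simp_rw [fun t : ℝ => ((hexp |z|).mul_right (t ^ (a - 1) * (1 - t) ^ (b - a - 1))).tsum_eq]
      exact hw.const_mul _
    · exact Filter.Eventually.of_forall fun t => (hexp (z * t)).mul_right _
  refine HasSum.unique ?_ h1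
  convert! (hasSum_gammaSeries ha (ha.trans hab) z).mul_left (Real.Gamma (b - a)) using 2 with n
  have h2 : ∫ t in Ioo (0 : ℝ) 1, (z * t) ^ n / n ! * (t ^ (a - 1) * (1 - t) ^ (b - a - 1)) =
      ∫ t in Ioo (0 : ℝ) 1, z ^ n / n ! * (t ^ (a + n - 1) * (1 - t) ^ (b - a - 1)) := by
    refine setIntegral_congr_fun measurableSet_Ioo fun t ht => ?_
    have : t ^ (a + n - 1) = t ^ n * t ^ (a - 1) := by
      rw [← Real.rpow_natCast, ← Real.rpow_add ht.1]; congr 1; ring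
    rw [this]
    ring
  rw [h2, integral_const_mul, integral_beta (by positivity) hD]
  have : a + n + (b - a) = b + n := by ring
  rw [this]
  ring

/-! ### Behaviour of the series at `-∞` -/

theorem abs_one_sub_rpow_sub_one_le {p t : ℝ} (hp : 1 ≤ p) (ht : 0 < t) (ht1 : t < 1) :
    |(1 - t) ^ p - 1| ≤ p * t := by
  have h1 := one_add_mul_self_le_rpow_one_add (s := -t) (by linarith) hp
  have h2 : (1 - t) ^ p ≤ 1 :=
    Real.rpow_le_one (by linarith) (by linarith) (by linarith)
  rw [← sub_eq_add_neg] at h1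
  rw [abs_le]
  constructor <;> linarith

/-- Watson's lemma for Euler's integral: replacing `(1 - t) ^ (b - a - 1)` by `1` for all
`t > 0` turns Euler's integral into a Gamma integral, and the error is at most the Laplace transform
of `(b - a - 1) t ^ a`. -/
theorem gammaSeries_asymptotic_of_two_le {a b : ℝ} (ha : 0 < a) (hab : a + 2 ≤ b) :
    ∃ C : ℝ, ∀ z : ℝ, 0 < z →
      |gammaSeries a b (-z) - Real.Gamma a / Real.Gamma (b - a) * z ^ (-a)| ≤
        C * z ^ (-a - 1) := by
  have hG : 0 < Real.Gamma (b - a) := Real.Gamma_pos_of_pos (by linarith)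
  refine ⟨(b - a - 1) * Real.Gamma (a + 1) / Real.Gamma (b - a), fun z hz => ?_⟩
  have hint : ∀ c : ℝ, 0 < c →
      IntegrableOn (fun t : ℝ => t ^ (c - 1) * Real.exp (-(z * t))) (Ioi 0) := fun c hc => by
    have := integrableOn_rpow_mul_exp_neg_mul_rpow (p := 1) (s := c - 1) (b := z)
      (by linarith) zero_lt_one hz
    simpa using this
  have hval : ∀ c : ℝ, 0 < c →
      ∫ t in Ioi (0 : ℝ), t ^ (c - 1) * Real.exp (-(z * t)) = z ^ (-c) * Real.Gamma c :=
    fun c hc => by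
      rw [Real.integral_rpow_mul_exp_neg_mul_Ioi hc hz, one_div, Real.inv_rpow hz.le,
        Real.rpow_neg hz.le]
  have heuler : Real.Gamma (b - a) * gammaSeries a b (-z) = ∫ t in Ioi (0 : ℝ),
      (Ioo (0 : ℝ) 1).indicator
        (fun t => Real.exp (-z * t) * (t ^ (a - 1) * (1 - t) ^ (b - a - 1))) t := by
    rw [Gamma_mul_gammaSeries ha (by linarith), setIntegral_indicator measurableSet_Ioo,
      inter_eq_self_of_subset_right Ioo_subset_Ioi_self]
  have hi : IntegrableOn ((Ioo (0 : ℝ) 1).indicator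
      (fun t => Real.exp (-z * t) * (t ^ (a - 1) * (1 - t) ^ (b - a - 1)))) (Ioi 0) := by
    refine IntegrableOn.integrable_indicator ?_ measurableSet_Ioo |>.integrableOn
    refine (integrableOn_beta ha (by linarith : 0 < b - a)).bdd_mul (c := 1)
      (Continuous.aestronglyMeasurable (by fun_prop)) ?_
    filter_upwards [ae_restrict_mem measurableSet_Ioo] with t ht
    rw [Real.norm_of_nonneg (Real.exp_pos _).le, Real.exp_le_one_iff]
    nlinarith [ht.1]
  have hdiff : |Real.Gamma (b - a) * gammaSeries a b (-z) - z ^ (-a) * Real.Gamma a| ≤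
      (b - a - 1) * (z ^ (-(a + 1)) * Real.Gamma (a + 1)) := by
    rw [heuler, ← hval a ha, ← hval (a + 1) (by linarith), ← integral_sub hi (hint a ha),
      ← integral_const_mul, ← Real.norm_eq_abs]
    refine norm_integral_le_of_norm_le ((hint (a + 1) (by linarith)).const_mul _) ?_
    filter_upwards [ae_restrict_mem measurableSet_Ioi] with t ht
    have ht0 : 0 < t := ht
    have hpow : t ^ (a + 1 - 1) = t * t ^ (a - 1) := by
      rw [← Real.rpow_one_add' ht0.le (by linarith)]; congr 1; ring
    have hnn : 0 ≤ t ^ (a - 1) * Real.exp (-(z * t)) := by positivity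
    rw [hpow, Real.norm_eq_abs]
    by_cases ht1 : t < 1
    · rw [indicator_of_mem (show t ∈ Ioo (0 : ℝ) 1 from ⟨ht0, ht1⟩)]
      have h := abs_one_sub_rpow_sub_one_le (p := b - a - 1) (by linarith) ht0 ht1
      have e : Real.exp (-z * t) * (t ^ (a - 1) * (1 - t) ^ (b - a - 1)) -
          t ^ (a - 1) * Real.exp (-(z * t)) =
          t ^ (a - 1) * Real.exp (-(z * t)) * ((1 - t) ^ (b - a - 1) - 1) := by
        rw [neg_mul]; ring
      rw [e, abs_mul, abs_of_nonneg hnn]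
      calc _ ≤ t ^ (a - 1) * Real.exp (-(z * t)) * ((b - a - 1) * t) := by gcongr
        _ = _ := by ring
    · rw [indicator_of_notMem (fun h => ht1 h.2), zero_sub, abs_neg, abs_of_nonneg hnn]
      have : 1 ≤ (b - a - 1) * t := by nlinarith [not_lt.1 ht1]
      calc _ = 1 * (t ^ (a - 1) * Real.exp (-(z * t))) := by ring
        _ ≤ ((b - a - 1) * t) * (t ^ (a - 1) * Real.exp (-(z * t))) := by gcongr
        _ = _ := by ring
  have e : gammaSeries a b (-z) - Real.Gamma a / Real.Gamma (b - a) * z ^ (-a) =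
      (Real.Gamma (b - a) * gammaSeries a b (-z) - z ^ (-a) * Real.Gamma a) /
        Real.Gamma (b - a) := by
    field_simp
  rw [e, abs_div, abs_of_pos hG, div_le_iff₀ hG]
  refine hdiff.trans (le_of_eq ?_)
  rw [show -(a + 1) = -a - 1 by ring]
  field_simp

theorem Real.inv_Gamma_eq_self_mul_inv_Gamma_add_one (x : ℝ) :
    (Real.Gamma x)⁻¹ = x * (Real.Gamma (x + 1))⁻¹ := by
  have h := Complex.one_div_Gamma_eq_self_mul_one_div_Gamma_add_one x
  rw [show (x : ℂ) + 1 = ((x + 1 : ℝ) : ℂ) by push_cast; rfl, Complex.Gamma_ofReal,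
    Complex.Gamma_ofReal] at h
  exact_mod_cast h

/-- The leading behaviour at `-∞`, for all positive parameters. The coefficient vanishes when
`b - a` is a non-positive integer, in agreement with the convention `Γ(-k) = 0`, `0⁻¹ = 0`. The
contiguous relation reduces the claim to large `b - a`, where Euler's integral is available. -/
theorem gammaSeries_asymptotic {a b : ℝ} (ha : 0 < a) (hb : 0 < b) :
    ∃ C : ℝ, ∀ z : ℝ, 0 < z →
      |gammaSeries a b (-z) - Real.Gamma a / Real.Gamma (b - a) * z ^ (-a)| ≤
        C * z ^ (-a - 1) := by
  obtain ⟨k, hk⟩ := exists_nat_ge (a + 2 - b)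
  induction k generalizing a b with
  | zero => exact gammaSeries_asymptotic_of_two_le ha (by simpa using hk)
  | succ k ih =>
    push_cast at hk
    obtain ⟨C₁, h₁⟩ := ih (a := a) (b := b + 1) ha (by linarith) (by linarith)
    obtain ⟨C₂, h₂⟩ := ih (a := a + 1) (b := b + 2) (by linarith) (by linarith) (by linarith)
    refine ⟨b * C₁ + C₂, fun z hz => ?_⟩
    specialize h₁ z hz
    specialize h₂ z hz
    have e1 : b + 1 - a = b - a + 1 := by ring
    have e2 : b + 2 - (a + 1) = b - a + 1 := by ring
    have p1 : z * z ^ (-(a + 1)) = z ^ (-a) := by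
      nth_rewrite 1 [← Real.rpow_one z]
      rw [← Real.rpow_add hz]; congr 1; ring
    have p2 : z * z ^ (-(a + 1) - 1) = z ^ (-a - 1) := by
      nth_rewrite 1 [← Real.rpow_one z]
      rw [← Real.rpow_add hz]; congr 1; ring
    rw [e1] at h₁
    rw [e2, Real.Gamma_add_one ha.ne'] at h₂
    have key : gammaSeries a b (-z) - Real.Gamma a / Real.Gamma (b - a) * z ^ (-a) =
        b * (gammaSeries a (b + 1) (-z) - Real.Gamma a / Real.Gamma (b - a + 1) * z ^ (-a)) -
        z * (gammaSeries (a + 1) (b + 2) (-z) -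
          a * Real.Gamma a / Real.Gamma (b - a + 1) * z ^ (-(a + 1))) := by
      rw [gammaSeries_contiguous ha hb, div_eq_mul_inv (Real.Gamma a),
        Real.inv_Gamma_eq_self_mul_inv_Gamma_add_one, ← p1]
      ring
    rw [key]
    calc _ ≤ |b * (gammaSeries a (b + 1) (-z) -
            Real.Gamma a / Real.Gamma (b - a + 1) * z ^ (-a))| +
          |z * (gammaSeries (a + 1) (b + 2) (-z) -
            a * Real.Gamma a / Real.Gamma (b - a + 1) * z ^ (-(a + 1)))| := abs_sub _ _
      _ ≤ b * (C₁ * z ^ (-a - 1)) + z * (C₂ * z ^ (-(a + 1) - 1)) := by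
          rw [abs_mul, abs_mul, abs_of_pos hb, abs_of_pos hz]
          gcongr
      _ = _ := by rw [← p2]; ring

/-! ### Polar coordinates -/

section Polar

variable {E : Type*} [NormedAddCommGroup E] [NormedSpace ℝ E] [Nontrivial E]
  [FiniteDimensional ℝ E] [MeasurableSpace E] [BorelSpace E]

/-- Polar coordinates for a product of a radial function and a function of the direction. No
integrability is assumed: if the integrand is not integrable, both sides are zero. -/
theorem integral_norm_mul_direction (μ : Measure E) [μ.IsAddHaarMeasure] (g : ℝ → ℝ)
    (h : E → ℝ) :
    ∫ x, g ‖x‖ * h (‖x‖⁻¹ • x) ∂μ =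
      (∫ w : Metric.sphere (0 : E) 1, h w ∂μ.toSphere) *
        ∫ r in Ioi (0 : ℝ), r ^ (Module.finrank ℝ E - 1) * g r := by
  calc
    ∫ x, g ‖x‖ * h (‖x‖⁻¹ • x) ∂μ
        = ∫ x : ({(0)}ᶜ : Set E), g ‖x.1‖ * h (‖x.1‖⁻¹ • x.1) ∂(μ.comap (↑)) := by
      rw [integral_subtype_comap (measurableSet_singleton _).compl
        fun x ↦ g ‖x‖ * h (‖x‖⁻¹ • x), restrict_compl_singleton]
    _ = ∫ p, h p.1 * g p.2 ∂μ.toSphere.prod (.volumeIoiPow (Module.finrank ℝ E - 1)) := by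
      rw [← μ.measurePreserving_homeomorphUnitSphereProd.integral_comp
        (Homeomorph.measurableEmbedding _)]
      simp [mul_comm]
    _ = (∫ w : Metric.sphere (0 : E) 1, h w ∂μ.toSphere) *
          ∫ r : Ioi (0 : ℝ), g r ∂.volumeIoiPow (Module.finrank ℝ E - 1) :=
      integral_prod_mul (fun w : Metric.sphere (0 : E) 1 => h w) (fun r : Ioi (0 : ℝ) => g r)
    _ = _ := by
      simp only [Measure.volumeIoiPow, ENNReal.ofReal]
      rw [integral_withDensity_eq_integral_smul,
        integral_subtype_comap measurableSet_Ioi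
          fun a ↦ Real.toNNReal (a ^ (Module.finrank ℝ E - 1)) • g a,
        setIntegral_congr_fun measurableSet_Ioi fun x hx ↦ ?_]
      · rw [NNReal.smul_def, Real.coe_toNNReal _ (pow_nonneg hx.out.le _), smul_eq_mul]
      · exact (measurable_subtype_coe.pow_const _).real_toNNReal

end Polar

/-! ### Moments of Gaussian weights -/

section Moments

variable {d : ℕ}

local notation "𝔼" => EuclideanSpace ℝ (Fin d)

/-- The weight `|ξ|^q e^{-|ξ|²/4}` as a function of the radius `r = |ξ|`. The square is a real power,
the form in which Mathlib states the radial Gamma integrals. -/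
noncomputable def gaussWeight (q r : ℝ) : ℝ := r ^ q * Real.exp (-(1 / 4) * r ^ (2 : ℝ))

/-- The moment `∫ |ξ|^q e^{-|ξ|²/4} (x·ξ)ⁿ dξ`. -/
noncomputable def gaussMoment (q : ℝ) (n : ℕ) (x : EuclideanSpace ℝ (Fin d)) : ℝ :=
  ∫ ξ : EuclideanSpace ℝ (Fin d), gaussWeight q ‖ξ‖ * (inner ℝ x ξ) ^ n

theorem gaussWeight_nonneg (q : ℝ) {r : ℝ} (hr : 0 ≤ r) : 0 ≤ gaussWeight q r := by
  unfold gaussWeight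
  positivity

theorem measurable_gaussWeight (q : ℝ) : Measurable (gaussWeight q) := by
  unfold gaussWeight
  fun_prop

theorem integrable_gaussWeight_mul_exp (hd : 1 ≤ d) {q : ℝ} (hq : 0 ≤ q) (k : ℝ) :
    Integrable (fun ξ : 𝔼 => gaussWeight q ‖ξ‖ * Real.exp (k * ‖ξ‖)) := by
  have : Nonempty (Fin d) := ⟨⟨0, hd⟩⟩
  refine (integrable_fun_norm_addHaar (volume : Measure 𝔼)
    (f := fun r => gaussWeight q r * Real.exp (k * r))).2 ?_
  have h := integrableOn_rpow_mul_exp_neg_mul_rpow (p := 2) (s := (d - 1 : ℕ) + q) (b := 1 / 8)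
    (by have : (0 : ℝ) ≤ (d - 1 : ℕ) := Nat.cast_nonneg _; linarith) (by norm_num) (by norm_num)
  refine (h.const_mul (Real.exp (2 * k ^ 2))).mono' ?_ ?_
  · exact Measurable.aestronglyMeasurable
      ((measurable_id.pow_const _).smul ((measurable_gaussWeight q).mul (by fun_prop)))
  · filter_upwards [ae_restrict_mem measurableSet_Ioi] with r hr
    have hr0 : 0 < r := hr
    have h0 := gaussWeight_nonneg q hr0.le
    rw [Real.norm_of_nonneg (by positivity), finrank_euclideanSpace_fin, smul_eq_mul, gaussWeight,
      Real.rpow_add hr0, Real.rpow_natCast, Real.rpow_two]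
    -- `k r ≤ r²/8 + 2 k²`, so half of the Gaussian decay absorbs the exponential growth
    have he : Real.exp (-(1 / 4) * r ^ 2) * Real.exp (k * r) ≤
        Real.exp (2 * k ^ 2) * Real.exp (-(1 / 8) * r ^ 2) := by
      rw [← Real.exp_add, ← Real.exp_add, Real.exp_le_exp]
      nlinarith [sq_nonneg (r - 4 * k)]
    calc _ = r ^ (d - 1) * r ^ q * (Real.exp (-(1 / 4) * r ^ 2) * Real.exp (k * r)) := by ring
      _ ≤ r ^ (d - 1) * r ^ q * (Real.exp (2 * k ^ 2) * Real.exp (-(1 / 8) * r ^ 2)) := by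
        gcongr
      _ = _ := by ring

theorem integrable_gaussWeight (hd : 1 ≤ d) {q : ℝ} (hq : 0 ≤ q) :
    Integrable (fun ξ : 𝔼 => gaussWeight q ‖ξ‖) := by
  simpa using integrable_gaussWeight_mul_exp hd hq 0

/-- The integral of the weight against `e^{z x·ξ}`, expanded in powers of `z`. For `z = i` this is
the integral in the inverse Fourier transform. -/
theorem hasSum_gaussMoment (hd : 1 ≤ d) {q : ℝ} (hq : 0 ≤ q) (x : 𝔼) (z : ℂ) :
    HasSum (fun n : ℕ => z ^ n * ((gaussMoment q n x : ℂ) / n !))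
      (∫ ξ : 𝔼, (gaussWeight q ‖ξ‖ : ℂ) * Complex.exp (z * ((inner ℝ x ξ : ℝ) : ℂ))) := by
  have hexp : ∀ y : ℂ, HasSum (fun n : ℕ => y ^ n / n !) (Complex.exp y) := fun y => by
    rw [Complex.exp_eq_exp_ℂ]; exact NormedSpace.expSeries_div_hasSum_exp y
  have hexpr : ∀ y : ℝ, HasSum (fun n : ℕ => y ^ n / n !) (Real.exp y) := fun y => by
    rw [Real.exp_eq_exp_ℝ]; exact NormedSpace.expSeries_div_hasSum_exp y
  have h1 : HasSum (fun n : ℕ => ∫ ξ : 𝔼,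
      (gaussWeight q ‖ξ‖ : ℂ) * ((z * ((inner ℝ x ξ : ℝ) : ℂ)) ^ n / n !))
      (∫ ξ : 𝔼, (gaussWeight q ‖ξ‖ : ℂ) * Complex.exp (z * ((inner ℝ x ξ : ℝ) : ℂ))) := by
    refine hasSum_integral_of_dominated_convergence
      (fun n ξ => gaussWeight q ‖ξ‖ * ((‖z‖ * ‖x‖ * ‖ξ‖) ^ n / n !)) (fun n => ?_)
      (fun n => ?_) ?_ ?_ ?_
    · have hm := measurable_gaussWeight q
      exact Measurable.aestronglyMeasurable (by fun_prop)
    · refine Filter.Eventually.of_forall fun ξ => ?_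
      have h0 := gaussWeight_nonneg q (norm_nonneg ξ)
      rw [norm_mul, Complex.norm_real, Real.norm_of_nonneg h0, norm_div, norm_pow, norm_mul,
        Complex.norm_real, Complex.norm_natCast, mul_assoc ‖z‖]
      have := norm_inner_le_norm (𝕜 := ℝ) x ξ
      gcongr
    · exact Filter.Eventually.of_forall fun ξ => (hexpr _).summable.mul_left _
    · simp_rw [fun ξ : 𝔼 => ((hexpr (‖z‖ * ‖x‖ * ‖ξ‖)).mul_left (gaussWeight q ‖ξ‖)).tsum_eq]
      exact integrable_gaussWeight_mul_exp hd hq _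
    · exact Filter.Eventually.of_forall fun ξ => (hexp _).mul_left _
  convert! h1 using 2 with n
  rw [gaussMoment, ← integral_complex_ofReal, ← integral_div, ← integral_const_mul]
  refine integral_congr_ae (Filter.Eventually.of_forall fun ξ => ?_)
  push_cast
  ring

/-- In polar coordinates the weight only enters a moment through a radial Gamma integral, so that
changing the exponent multiplies the moment by an explicit factor. -/
theorem gaussMoment_eq (hd : 1 ≤ d) {q : ℝ} (hq : 0 ≤ q) (n : ℕ) (x : 𝔼) :
    gaussMoment q n x = 2 ^ q * Real.Gamma (q / 2 + (d + n) / 2) / Real.Gamma ((d + n) / 2 : ℝ) *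
      gaussMoment 0 n x := by
  have : Nonempty (Fin d) := ⟨⟨0, hd⟩⟩
  have hd' : (0 : ℝ) < d := by exact_mod_cast hd
  have key : ∀ p : ℝ, 0 ≤ p → gaussMoment p n x =
      (∫ w : Metric.sphere (0 : 𝔼) 1, (inner ℝ x (w : 𝔼)) ^ n ∂(volume : Measure 𝔼).toSphere) *
        (2 ^ (p + d + n) * (1 / 2) * Real.Gamma (p / 2 + (d + n) / 2)) := by
    intro p hp
    -- at `ξ = 0` the identity holds for `n = 0` as well, both sides having the `0`-th power `1`
    have h1 : gaussMoment p n x =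
        ∫ ξ : 𝔼, (gaussWeight p ‖ξ‖ * ‖ξ‖ ^ n) * (inner ℝ x (‖ξ‖⁻¹ • ξ)) ^ n := by
      refine integral_congr_ae (Filter.Eventually.of_forall fun ξ => ?_)
      rcases eq_or_ne ξ 0 with rfl | hξ
      · cases n <;> simp
      · have : ‖ξ‖ ≠ 0 := norm_ne_zero_iff.2 hξ
        simp only [inner_smul_right]
        rw [mul_assoc, ← mul_pow, mul_inv_cancel_left₀ this]
    rw [h1, integral_norm_mul_direction volume (fun r => gaussWeight p r * r ^ n)
      (fun w => (inner ℝ x w) ^ n)]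
    congr 1
    have hpow : ∀ r ∈ Ioi (0 : ℝ), r ^ (Module.finrank ℝ 𝔼 - 1) * (gaussWeight p r * r ^ n) =
        r ^ (p + d + n - 1) * Real.exp (-(1 / 4) * r ^ (2 : ℝ)) := by
      intro r hr
      have hr0 : 0 < r := hr
      have e : p + d + n - 1 = ((d - 1 : ℕ) : ℝ) + p + n := by
        rw [Nat.cast_sub hd]; push_cast; ring
      rw [finrank_euclideanSpace_fin, gaussWeight, e, Real.rpow_add hr0, Real.rpow_add hr0,
        Real.rpow_natCast, Real.rpow_natCast]
      ring
    rw [setIntegral_congr_fun measurableSet_Ioi hpow, integral_rpow_mul_exp_neg_mul_rpow two_pos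
      (by have : (0 : ℝ) ≤ n := n.cast_nonneg; linarith) (by norm_num)]
    have e4 : (1 / 4 : ℝ) ^ (-(p + d + n - 1 + 1) / 2) = 2 ^ (p + d + n) := by
      rw [show (1 / 4 : ℝ) = 2 ^ (-2 : ℝ) by
        rw [Real.rpow_neg two_pos.le, Real.rpow_two]; norm_num, ← Real.rpow_mul two_pos.le]
      congr 1; ring
    rw [e4]
    congr 2
    ring
  have hG : Real.Gamma ((d + n) / 2 : ℝ) ≠ 0 := (Real.Gamma_pos_of_pos (by positivity)).ne'
  rw [key q hq, key 0 le_rfl, zero_div, zero_add, zero_add, add_assoc, Real.rpow_add two_pos]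
  field_simp

theorem integral_gaussWeight_zero_mul_cexp (x : 𝔼) (z : ℂ) :
    ∫ ξ : 𝔼, (gaussWeight 0 ‖ξ‖ : ℂ) * Complex.exp (z * ((inner ℝ x ξ : ℝ) : ℂ)) =
      (((4 * Real.pi) ^ ((d : ℝ) / 2) : ℝ) : ℂ) * Complex.exp (z ^ 2 * ‖x‖ ^ 2) := by
  have h := GaussianFourier.integral_cexp_neg_mul_sq_norm_add (V := 𝔼) (b := 1 / 4)
    (by norm_num) z x
  rw [finrank_euclideanSpace_fin] at h
  have e1 : ((Real.pi : ℂ) / (1 / 4)) ^ ((d : ℂ) / 2) =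
      (((4 * Real.pi) ^ ((d : ℝ) / 2) : ℝ) : ℂ) := by
    rw [Complex.ofReal_cpow (by positivity)]
    push_cast
    congr 1
    ring
  have e2 : z ^ 2 * (‖x‖ : ℂ) ^ 2 / (4 * (1 / 4)) = z ^ 2 * (‖x‖ : ℂ) ^ 2 := by ring
  rw [e1, e2] at h
  rw [← h]
  refine integral_congr_ae (Filter.Eventually.of_forall fun ξ => ?_)
  simp only [gaussWeight, Real.rpow_zero, one_mul, Real.rpow_two]
  rw [Complex.ofReal_exp, ← Complex.exp_add]
  push_cast
  rfl

theorem eq_of_hasSum_pow_mul {a b : ℕ → ℂ} {f : ℂ → ℂ}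
    (ha : ∀ z, HasSum (fun n => z ^ n * a n) (f z))
    (hb : ∀ z, HasSum (fun n => z ^ n * b n) (f z)) : a = b := by
  have key : ∀ c : ℕ → ℂ, (∀ z, HasSum (fun n => z ^ n * c n) (f z)) →
      HasFPowerSeriesAt f (FormalMultilinearSeries.ofScalars ℂ c) 0 := fun c hc => by
    rw [hasFPowerSeriesAt_iff]
    refine Filter.Eventually.of_forall fun z => ?_
    simpa [FormalMultilinearSeries.coeff_ofScalars] using hc z
  have h := (key a ha).eq_formalMultilinearSeries (key b hb)
  funext n
  simpa [FormalMultilinearSeries.coeff_ofScalars] using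
    congrArg (fun p => FormalMultilinearSeries.coeff p n) h

/-- The moments of the Gaussian, read off from its Fourier transform. -/
theorem gaussMoment_zero (hd : 1 ≤ d) (x : 𝔼) :
    (∀ k : ℕ, gaussMoment 0 (2 * k) x / (2 * k)! =
      (4 * Real.pi) ^ ((d : ℝ) / 2) * ((‖x‖ ^ 2) ^ k / k !)) ∧
    ∀ k : ℕ, gaussMoment 0 (2 * k + 1) x = 0 := by
  set c : ℝ := (4 * Real.pi) ^ ((d : ℝ) / 2)
  let b : ℕ → ℂ := fun n => if Even n then (c : ℂ) * (((‖x‖ : ℂ) ^ 2) ^ (n / 2) / (n / 2)!) else 0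
  have hb : ∀ z : ℂ, HasSum (fun n => z ^ n * b n)
      ((c : ℂ) * Complex.exp (z ^ 2 * ‖x‖ ^ 2)) := fun z => by
    have he : HasSum (fun k : ℕ => z ^ (2 * k) * b (2 * k))
        ((c : ℂ) * Complex.exp (z ^ 2 * ‖x‖ ^ 2)) := by
      rw [Complex.exp_eq_exp_ℂ]
      convert! (NormedSpace.expSeries_div_hasSum_exp (z ^ 2 * (‖x‖ : ℂ) ^ 2)).mul_left (c : ℂ)
        using 2 with k
      simp only [b, even_two_mul, if_true, Nat.mul_div_cancel_left k two_pos, mul_pow, pow_mul]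
      ring
    have ho : HasSum (fun k : ℕ => z ^ (2 * k + 1) * b (2 * k + 1)) 0 := by
      have : (fun k : ℕ => z ^ (2 * k + 1) * b (2 * k + 1)) = fun _ => 0 := by
        funext k; simp [b]
      rw [this]
      exact hasSum_zero
    simpa only [add_zero] using HasSum.even_add_odd (f := fun n => z ^ n * b n) he ho
  have hab := eq_of_hasSum_pow_mul (a := fun n : ℕ => (gaussMoment 0 n x : ℂ) / n !)
    (fun z => by
      have h := hasSum_gaussMoment hd le_rfl x z
      rwa [integral_gaussWeight_zero_mul_cexp] at h) hb
  constructor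
  · intro k
    have h := congrFun hab (2 * k)
    simp only [b, even_two_mul, if_true, Nat.mul_div_cancel_left k two_pos] at h
    exact_mod_cast h
  · intro k
    have h := congrFun hab (2 * k + 1)
    have hf : (((2 * k + 1)! : ℕ) : ℂ) ≠ 0 := by exact_mod_cast Nat.factorial_ne_zero _
    simp only [b, Nat.not_even_bit1, if_false, div_eq_zero_iff, hf, or_false] at h
    exact_mod_cast h

/-- The inverse Fourier integral of the weight, summed through its moments. -/
theorem integral_gaussWeight_mul_cexp (hd : 1 ≤ d) {s : ℝ} (hs : 0 ≤ s) (x : 𝔼) :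
    ∫ ξ : 𝔼, (gaussWeight (2 * s) ‖ξ‖ : ℂ) *
        Complex.exp (Complex.I * ((inner ℝ x ξ : ℝ) : ℂ)) =
      (((4 * Real.pi) ^ ((d : ℝ) / 2) * (2 ^ (2 * s) *
        gammaSeries (s + d / 2) (d / 2) (-‖x‖ ^ 2)) : ℝ) : ℂ) := by
  have hd' : (0 : ℝ) < d := by exact_mod_cast hd
  obtain ⟨heven, hodd⟩ := gaussMoment_zero hd x
  refine (hasSum_gaussMoment hd (by linarith) x Complex.I).unique ?_
  have ho : HasSum (fun k : ℕ => Complex.I ^ (2 * k + 1) *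
      ((gaussMoment (2 * s) (2 * k + 1) x : ℂ) / (2 * k + 1)!)) 0 := by
    simp only [gaussMoment_eq hd (by linarith : 0 ≤ 2 * s), hodd, mul_zero, Complex.ofReal_zero,
      zero_div]
    exact hasSum_zero
  have he : HasSum (fun k : ℕ => Complex.I ^ (2 * k) *
      ((gaussMoment (2 * s) (2 * k) x : ℂ) / (2 * k)!))
      (((4 * Real.pi) ^ ((d : ℝ) / 2) * (2 ^ (2 * s) *
        gammaSeries (s + d / 2) (d / 2) (-‖x‖ ^ 2)) : ℝ) : ℂ) := by
    have h := Complex.hasSum_ofReal.2 (((hasSum_gammaSeries (by positivity : 0 < s + d / 2)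
      (by positivity : 0 < (d : ℝ) / 2) (-‖x‖ ^ 2)).mul_left (2 ^ (2 * s))).mul_left
        ((4 * Real.pi) ^ ((d : ℝ) / 2)))
    convert! h using 2 with k
    have hI : Complex.I ^ (2 * k) = (((-1) ^ k : ℝ) : ℂ) := by
      rw [pow_mul, Complex.I_sq]; push_cast; rfl
    rw [hI, ← Complex.ofReal_natCast (2 * k)!, ← Complex.ofReal_div, ← Complex.ofReal_mul,
      gaussMoment_eq hd (by linarith : 0 ≤ 2 * s), mul_div_assoc, heven k, neg_pow (‖x‖ ^ 2)]
    congr 1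
    have e1 : 2 * s / 2 + (d + (2 * k : ℕ)) / 2 = s + d / 2 + k := by push_cast; ring
    have e2 : ((d : ℝ) + (2 * k : ℕ)) / 2 = d / 2 + k := by push_cast; ring
    rw [e1, e2]
    ring
  simpa only [add_zero] using HasSum.even_add_odd
    (f := fun n : ℕ => Complex.I ^ n * ((gaussMoment (2 * s) n x : ℂ) / n !)) he ho

end Moments

/-! ### The fractional Laplacian of the Gaussian -/

section FracLaplacian

variable {d : ℕ}

theorem integrable_gaussianFn (d : ℕ) : Integrable (gaussianFn d) := by
  have h := GaussianFourier.integrable_cexp_neg_mul_sq_norm_add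
    (V := EuclideanSpace ℝ (Fin d)) (b := 1) (by norm_num) 0 0
  refine h.congr (Filter.Eventually.of_forall fun x => ?_)
  simp [gaussianFn]

theorem fourierTr_gaussianFn (ξ : EuclideanSpace ℝ (Fin d)) :
    fourierTr (gaussianFn d) ξ =
      ((2 ^ (-(d : ℝ) / 2) * Real.exp (-(1 / 4) * ‖ξ‖ ^ 2) : ℝ) : ℂ) := by
  have h := GaussianFourier.integral_cexp_neg_mul_sq_norm_add
    (V := EuclideanSpace ℝ (Fin d)) (b := 1) (by norm_num) (-Complex.I) ξ
  have e1 : ((Real.pi : ℂ) / 1) ^ ((d : ℂ) / 2) = ((Real.pi ^ ((d : ℝ) / 2) : ℝ) : ℂ) := by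
    rw [Complex.ofReal_cpow (by positivity), div_one]
    push_cast
    rfl
  have e2 : (-Complex.I) ^ 2 * (‖ξ‖ : ℂ) ^ 2 / (4 * 1) = ((-(1 / 4) * ‖ξ‖ ^ 2 : ℝ) : ℂ) := by
    rw [neg_sq, Complex.I_sq]
    push_cast
    ring
  rw [finrank_euclideanSpace_fin, e1, e2, ← Complex.ofReal_exp, ← Complex.ofReal_mul] at h
  have h2 : ∫ x : EuclideanSpace ℝ (Fin d),
      gaussianFn d x * Complex.exp (-(Complex.I * ((inner ℝ ξ x : ℝ) : ℂ))) =
      ((Real.pi ^ ((d : ℝ) / 2) * Real.exp (-(1 / 4) * ‖ξ‖ ^ 2) : ℝ) : ℂ) := by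
    rw [← h]
    refine integral_congr_ae (Filter.Eventually.of_forall fun x => ?_)
    simp only [gaussianFn]
    rw [Complex.ofReal_exp, ← Complex.exp_add]
    congr 1
    push_cast
    ring
  rw [fourierTr, h2, ← Complex.ofReal_mul, Real.mul_rpow two_pos.le Real.pi_pos.le]
  congr 1
  have : Real.pi ^ (-(d : ℝ) / 2) * Real.pi ^ ((d : ℝ) / 2) = 1 := by
    rw [← Real.rpow_add Real.pi_pos, neg_div, neg_add_cancel, Real.rpow_zero]
  linear_combination (2 ^ (-(d : ℝ) / 2) * Real.exp (-(1 / 4) * ‖ξ‖ ^ 2)) * this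

theorem fracLaplaceSymbol_gaussianFn (s : ℝ) (ξ : EuclideanSpace ℝ (Fin d)) :
    fracLaplaceSymbol s (gaussianFn d) ξ =
      ((2 ^ (-(d : ℝ) / 2) : ℝ) : ℂ) * (gaussWeight (2 * s) ‖ξ‖ : ℂ) := by
  rw [fracLaplaceSymbol, fourierTr_gaussianFn, ← Complex.ofReal_mul, ← Complex.ofReal_mul,
    gaussWeight, Real.rpow_two]
  congr 1
  ring

theorem integrable_fracLaplaceSymbol_gaussianFn (hd : 1 ≤ d) {s : ℝ} (hs : 0 ≤ s) :
    Integrable (fracLaplaceSymbol s (gaussianFn d)) := by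
  rw [funext (fracLaplaceSymbol_gaussianFn s)]
  exact (integrable_gaussWeight hd (by linarith)).ofReal.const_mul _

theorem fracLaplacian_gaussianFn (hd : 1 ≤ d) {s : ℝ} (hs : 0 ≤ s)
    (x : EuclideanSpace ℝ (Fin d)) :
    fracLaplacian s (gaussianFn d) x =
      ((2 ^ (2 * s) * gammaSeries (s + d / 2) (d / 2) (-‖x‖ ^ 2) : ℝ) : ℂ) := by
  rw [fracLaplacian, fourierTrInv]
  simp_rw [fracLaplaceSymbol_gaussianFn, mul_assoc]
  rw [integral_const_mul, integral_gaussWeight_mul_cexp hd hs, ← Complex.ofReal_mul,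
    ← Complex.ofReal_mul]
  congr 1
  have h4 : (4 * Real.pi) ^ ((d : ℝ) / 2) =
      (2 * Real.pi) ^ ((d : ℝ) / 2) * 2 ^ ((d : ℝ) / 2) := by
    rw [← Real.mul_rpow (by positivity) two_pos.le]
    congr 1
    ring
  have h1 : (2 * Real.pi) ^ (-(d : ℝ) / 2) * (2 * Real.pi) ^ ((d : ℝ) / 2) = 1 := by
    rw [← Real.rpow_add (by positivity), neg_div, neg_add_cancel, Real.rpow_zero]
  have h2 : (2 : ℝ) ^ (-(d : ℝ) / 2) * 2 ^ ((d : ℝ) / 2) = 1 := by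
    rw [← Real.rpow_add two_pos, neg_div, neg_add_cancel, Real.rpow_zero]
  rw [h4]
  generalize 2 ^ (2 * s) * gammaSeries (s + d / 2) (d / 2) (-‖x‖ ^ 2) = G
  calc _ = ((2 * Real.pi) ^ (-(d : ℝ) / 2) * (2 * Real.pi) ^ ((d : ℝ) / 2)) *
      ((2 : ℝ) ^ (-(d : ℝ) / 2) * 2 ^ ((d : ℝ) / 2)) * G := by ring
    _ = G := by rw [h1, h2, one_mul, one_mul]

/-- The reflection formula turns the coefficient `1 / Γ(-s)` into the sine of the asymptotics. -/
theorem neg_sin_div_pi_mul_Gamma {s : ℝ} (hs : 0 < s) (hsn : ∀ n : ℤ, s ≠ n) :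
    -(Real.sin (Real.pi * s) / Real.pi) * Real.Gamma (1 + s) = (Real.Gamma (-s))⁻¹ := by
  have h := Real.Gamma_mul_Gamma_one_sub (-s)
  have hG : Real.Gamma (-s) ≠ 0 := Real.Gamma_ne_zero fun m hm => hsn m (by
    rw [neg_inj.1 hm]; simp)
  have hG1 : Real.Gamma (1 + s) ≠ 0 := (Real.Gamma_pos_of_pos (by linarith)).ne'
  have hpi := Real.pi_ne_zero
  rw [sub_neg_eq_add, mul_neg, Real.sin_neg, div_neg] at h
  have hsin : Real.sin (Real.pi * s) ≠ 0 := fun h0 => by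
    rw [h0, div_zero, neg_zero] at h
    exact mul_ne_zero hG hG1 h
  refine eq_inv_of_mul_eq_one_left ?_
  calc _ = -(Real.sin (Real.pi * s) / Real.pi) *
        (Real.Gamma (-s) * Real.Gamma (1 + s)) := by ring
    _ = 1 := by rw [h]; field_simp

end FracLaplacian

theorem mainTheorem5 (d : ℕ) (hd : 1 ≤ d) (s : ℝ) (hs : 0 < s) :
    -- the integrals defining the fractional Laplacian of the Gaussian converge
    MeasureTheory.Integrable (gaussianFn d) ∧
    MeasureTheory.Integrable (fracLaplaceSymbol s (gaussianFn d)) ∧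
    -- the closed formula, at every point
    (∀ x : EuclideanSpace ℝ (Fin d),
      fracLaplacian s (gaussianFn d) x =
        ((2 ^ (2 * s) * Real.Gamma (s + d / 2) / Real.Gamma (d / 2) : ℝ) : ℂ) *
          kummer1F1 ((s + d / 2 : ℝ) : ℂ) ((d / 2 : ℝ) : ℂ) ((-‖x‖ ^ 2 : ℝ) : ℂ)) ∧
    -- the asymptotic behaviour at infinity
    ((∀ n : ℤ, s ≠ n) →
      ∃ E : EuclideanSpace ℝ (Fin d) → ℝ,
        E =O[Bornology.cobounded (EuclideanSpace ℝ (Fin d))] (fun x => ‖x‖ ^ (-2 : ℝ)) ∧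
        ∀ x : EuclideanSpace ℝ (Fin d), x ≠ 0 →
          fracLaplacian s (gaussianFn d) x =
            ((-(2 ^ (2 * s) * Real.sin (Real.pi * s) / Real.pi) *
              (Real.Gamma (s + d / 2) * Real.Gamma (1 + s) / ‖x‖ ^ (d + 2 * s)) *
              (1 + E x) : ℝ) : ℂ)) := by
  have hd' : (0 : ℝ) < d := by exact_mod_cast hd
  have ha : 0 < s + d / 2 := by positivity
  have hb : 0 < (d : ℝ) / 2 := by positivity
  refine ⟨integrable_gaussianFn d, integrable_fracLaplaceSymbol_gaussianFn hd hs.le,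
    fun x => ?_, fun hsn => ?_⟩
  · rw [fracLaplacian_gaussianFn hd hs.le, Complex.ofReal_mul, ofReal_gammaSeries ha hb,
      ← mul_assoc, ← Complex.ofReal_mul, mul_div_assoc]
  · obtain ⟨C, hC⟩ := gammaSeries_asymptotic ha hb
    have hK : Real.Gamma (s + d / 2) / Real.Gamma (-s) ≠ 0 :=
      div_ne_zero (Real.Gamma_pos_of_pos ha).ne' (Real.Gamma_ne_zero fun m hm => hsn m (by
        rw [neg_inj.1 hm]; simp))
    set K : ℝ := Real.Gamma (s + d / 2) / Real.Gamma (-s)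
    -- the relative error is forced by the formula, since the coefficient `K` does not vanish
    refine ⟨fun x => gammaSeries (s + d / 2) (d / 2) (-‖x‖ ^ 2) * ‖x‖ ^ (d + 2 * s) / K - 1,
      ?_, fun x hx => ?_⟩
    · refine IsBigO.of_bound (C / |K|) ?_
      have hne : ∀ᶠ x in Bornology.cobounded (EuclideanSpace ℝ (Fin d)), 1 ≤ ‖x‖ :=
        tendsto_norm_cobounded_atTop.eventually_ge_atTop 1
      filter_upwards [hne] with x hx1
      have hx : 0 < ‖x‖ := by linarith
      have h := hC (‖x‖ ^ 2) (by positivity)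
      have e0 : (d : ℝ) / 2 - (s + d / 2) = -s := by ring
      rw [e0, ← Real.rpow_two, ← Real.rpow_mul hx.le, ← Real.rpow_mul hx.le] at h
      have p1 : ‖x‖ ^ (2 * -(s + d / 2)) * ‖x‖ ^ (d + 2 * s) = 1 := by
        rw [← Real.rpow_add hx]
        ring_nf
        exact Real.rpow_zero _
      have p2 : ‖x‖ ^ (2 * (-(s + d / 2) - 1)) * ‖x‖ ^ (d + 2 * s) = ‖x‖ ^ (-2 : ℝ) := by
        rw [← Real.rpow_add hx]
        ring_nf
      have hp : 0 < ‖x‖ ^ (d + 2 * s) := by positivity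
      have e : gammaSeries (s + d / 2) (d / 2) (-‖x‖ ^ 2) * ‖x‖ ^ (d + 2 * s) / K - 1 =
          (gammaSeries (s + d / 2) (d / 2) (-‖x‖ ^ (2 : ℝ)) -
            K * ‖x‖ ^ (2 * -(s + d / 2))) * ‖x‖ ^ (d + 2 * s) / K := by
        rw [sub_mul, mul_assoc K, p1, Real.rpow_two]
        field_simp
      rw [e, Real.norm_eq_abs, abs_div, abs_mul, abs_of_pos hp,
        Real.norm_of_nonneg (by positivity), div_mul_eq_mul_div C]
      refine div_le_div_of_nonneg_right ?_ (abs_nonneg K)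
      calc _ ≤ C * ‖x‖ ^ (2 * (-(s + d / 2) - 1)) * ‖x‖ ^ (d + 2 * s) := by gcongr
        _ = _ := by rw [mul_assoc, p2]
    · rw [fracLaplacian_gaussianFn hd hs.le]
      congr 1
      have hp : ‖x‖ ^ (d + 2 * s) ≠ 0 := (Real.rpow_pos_of_pos (norm_pos_iff.2 hx) _).ne'
      have e : -(2 ^ (2 * s) * Real.sin (Real.pi * s) / Real.pi) *
          (Real.Gamma (s + d / 2) * Real.Gamma (1 + s) / ‖x‖ ^ (d + 2 * s)) =
          2 ^ (2 * s) * K / ‖x‖ ^ (d + 2 * s) := by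
        rw [show K = Real.Gamma (s + d / 2) * (Real.Gamma (-s))⁻¹ from div_eq_mul_inv _ _,
          ← neg_sin_div_pi_mul_Gamma hs hsn]
        ring
      rw [e]
      field_simp
      ring
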